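/- Let $1\le q\le k$ and $N$ be integers, $0\le p<\infty$ and $0<\epsilon<1$. Let $M_1,\dots,M_N\in\mathbb R^{k\times k}$ be symmetric positive semidefinite matrices ($M_i$ is the information matrix of the $i$-th design point for a parameter $\theta\in\mathbb R^k$), let $g:\mathbb R^k\to\mathbb R^q$ be differentiable at $\theta$ and let $J=\partial g(\theta)/\partial\theta^T\in\mathbb R^{q\times k}$ be its Jacobian matrix. Put $$\Omega_\epsilon=\Big\{w\in\mathbb R^N:\ 0\le w_i\le\epsilon\ (1\le i\le N),\ \sum_{i=1}^N w_i=1\Big\},\qquad M(w)=\sum_{i=1}^N w_iM_i,\qquad \Omega_\epsilon^+=\{w\in\Omega_\epsilon:\ M(w)>0\},$$ where $M(w)>0$ means positive definite. If $M(w)>0$, put $\Sigma_g(w)=J\,M(w)^{-1}J^T$. For a symmetric positive semidefinite matrix $S\in\mathbb R^{q\times q}$ put $\Phi_p(S)=(q^{-1}\operatorname{Tr} S^p)^{1/p}$ if $p>0$ and $\Phi_0(S)=|S|^{1/q}$. When $\Phi_p(\Sigma_g(w))$ is minimized over a subset of $\Omega_\epsilon$, its value is taken to be $+\infty$ where $M(w)$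 is singular. For $w,w'\in\Omega_\epsilon^+$ let $$\eta(w',w)=\left.\frac{\partial}{\partial\alpha}\Phi_p\big(\Sigma_g((1-\alpha)w+\alpha w')\big)\right|_{\alpha=0}.$$ A positive steepest gradient (PSG) measure of $w\in\Omega_\epsilon^+$ is a $\tilde w\in\Omega_\epsilon^+$ such that $\eta(\tilde w,w)=\min_{w'\in\Omega_\epsilon^+}\eta(w',w)$. Let $(w^t)_{t\ge0}$ be any infinite sequence of iterates of the following algorithm (without a stopping rule). Start with some $w^0\in\Omega_\epsilon^+$. At iteration $t\ge1$, take a PSG measure $\tilde w^{t-1}$ of $w^{t-1}$, let $T_1^t=\{i: w_i^{t-1}=\tilde w_i^{t-1}=\epsilon\}$ and $T_2^t=\{i: w_i^{t-1}=\tilde w_i^{t-1}=0\}$, and let $w^t$ be a minimizer of $\Phi_p(\Sigma_g(w))$ subject to $w\in\Omega_\epsilon$, $w_i=\epsilon$ for $i\in T_1^t$ and $w_i=0$ for $i\in T_2^t$. Let $\hat w$ be a solution of $\min_{w\in\Omega_\epsilon}\Phi_p(\Sigma_g(w))$. Then $M(\hat w)$ and all the $M(w^t)$ are positive definite, and $$\lim_{t\to\infty}\Phi_p(\Sigma_g(w^t))=\Phi_p(\Sigma_g(\hat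 w)).$$ -/

import Mathlib

open Filter Topology

namespace PhiDesign

/-- The measures with weights bounded by `ε`: `w i ∈ [0, ε]` and `∑ i, w i = 1`. -/
def Omega (N : ℕ) (ε : ℝ) : Set (Fin N → ℝ) :=
  {w | (∀ i, 0 ≤ w i ∧ w i ≤ ε) ∧ ∑ i, w i = 1}

/-- The information matrix `M(w) = ∑ i, w i • M_i` of a measure `w`, where `A i = M_i` is the
information matrix of the `i`-th design point. -/
def infoMatrix {N k : ℕ} (A : Fin N → Matrix (Fin k) (Fin k) ℝ) (w : Fin N → ℝ) :
    Matrix (Fin k) (Fin k) ℝ :=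
  ∑ i, w i • A i

/-- The measures in `Omega N ε` with positive definite information matrix. -/
def OmegaPlus {N k : ℕ} (ε : ℝ) (A : Fin N → Matrix (Fin k) (Fin k) ℝ) : Set (Fin N → ℝ) :=
  {w | w ∈ Omega N ε ∧ (infoMatrix A w).PosDef}

/-- The Jacobian matrix `∂g(θ)/∂θᵀ`. -/
noncomputable def jacobian {k q : ℕ} (g : (Fin k → ℝ) → (Fin q → ℝ)) (θ : Fin k → ℝ) :
    Matrix (Fin q) (Fin k) ℝ :=
  LinearMap.toMatrix' (fderiv ℝ g θ : (Fin k → ℝ) →ₗ[ℝ] (Fin q → ℝ))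

/-- The covariance matrix `Σ_g(w) = J M(w)⁻¹ Jᵀ`, where `J` is the Jacobian matrix of `g`. It is
used only where `M(w)` is positive definite. -/
noncomputable def covMatrix {N k q : ℕ} (J : Matrix (Fin q) (Fin k) ℝ)
    (A : Fin N → Matrix (Fin k) (Fin k) ℝ) (w : Fin N → ℝ) : Matrix (Fin q) (Fin q) ℝ :=
  J * (infoMatrix A w)⁻¹ * J.transpose

/-- Kiefer's criterion `Φ_p(S) = (q⁻¹ Tr S^p)^(1/p)` for `p > 0`, with the real power `S^p` of the
symmetric positive semidefinite matrix `S` taken by the functional calculus, and its limit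
`|S|^(1/q)` for `p = 0`. -/
noncomputable def Phi {q : ℕ} (p : ℝ) (S : Matrix (Fin q) (Fin q) ℝ) : ℝ :=
  if p = 0 then S.det ^ (1 / (q : ℝ))
  else ((q : ℝ)⁻¹ * (cfc (fun x : ℝ => x ^ p) S).trace) ^ (1 / p)

open Classical in
/-- The objective function `w ↦ Φ_p(Σ_g(w))`, with the value `+∞` where `M(w)` is not positive
definite. -/
noncomputable def objective {N k q : ℕ} (p : ℝ) (J : Matrix (Fin q) (Fin k) ℝ)
    (A : Fin N → Matrix (Fin k) (Fin k) ℝ) (w : Fin N → ℝ) : EReal :=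
  if (infoMatrix A w).PosDef then ((Phi p (covMatrix J A w) : ℝ) : EReal) else ⊤

/-- `w` minimizes the objective function over the set `F`. -/
def IsSolution {N k q : ℕ} (p : ℝ) (J : Matrix (Fin q) (Fin k) ℝ)
    (A : Fin N → Matrix (Fin k) (Fin k) ℝ) (F : Set (Fin N → ℝ)) (w : Fin N → ℝ) : Prop :=
  w ∈ F ∧ ∀ w' ∈ F, objective p J A w ≤ objective p J A w'

/-- The directional derivative `η(w', w) = ∂Φ_p(Σ_g((1 - α) w + α w'))/∂α` at `α = 0`. Since
`(1 - α) w + α w'` is a measure only for `0 ≤ α ≤ 1`, it is taken from the right; where `M(w)` is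
positive definite this is also the two-sided derivative. -/
noncomputable def eta {N k q : ℕ} (p : ℝ) (J : Matrix (Fin q) (Fin k) ℝ)
    (A : Fin N → Matrix (Fin k) (Fin k) ℝ) (w' w : Fin N → ℝ) : ℝ :=
  derivWithin (fun α : ℝ => Phi p (covMatrix J A ((1 - α) • w + α • w'))) (Set.Ici 0) 0

/-- `v` is a positive steepest gradient (PSG) measure of `w`: it minimizes `η(·, w)` over the
measures with positive definite information matrix. -/
def IsPSG {N k q : ℕ} (p ε : ℝ) (J : Matrix (Fin q) (Fin k) ℝ)
    (A : Fin N → Matrix (Fin k) (Fin k) ℝ) (w v : Fin N → ℝ) : Prop :=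
  v ∈ OmegaPlus ε A ∧ ∀ w' ∈ OmegaPlus ε A, eta p J A v w ≤ eta p J A w' w

/-- The feasible set of an update, given a measure `w` and its PSG measure `v`: a weight that
equals `ε` in both, or `0` in both, keeps that value. -/
def updateSet {N : ℕ} (ε : ℝ) (w v : Fin N → ℝ) : Set (Fin N → ℝ) :=
  {u | u ∈ Omega N ε ∧ (∀ i, w i = ε → v i = ε → u i = ε) ∧ (∀ i, w i = 0 → v i = 0 → u i = 0)}

/-- `w 0, w 1, …` are iterates of the algorithm, with PSG measures `v 0, v 1, …`. -/
structure IsRun {N k q : ℕ} (p ε : ℝ) (J : Matrix (Fin q) (Fin k) ℝ)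
    (A : Fin N → Matrix (Fin k) (Fin k) ℝ) (w v : ℕ → Fin N → ℝ) : Prop where
  init : w 0 ∈ OmegaPlus ε A
  psg : ∀ t, IsPSG p ε J A (w t) (v t)
  update : ∀ t, IsSolution p J A (updateSet ε (w t) (v t)) (w (t + 1))

end PhiDesign

/-! The feasible set of an update depends only on two sets of indices, so there are finitely many.
The criterion never increases; when a feasible set recurs at times `s < t`, the optimality of `w (s
+ 1)` on it forces the criterion to be constant from `s + 1` to `t + 1`. Hence `w (s + 1)` is
already optimal for its own update. That update admits the segment towards its PSG measure, so the
steepest derivative is nonnegative, and so is the derivative in every direction.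

Convexity turns this into global optimality, and the criterion is constant from then on. What is
convex in `M` is an increasing transform of `Φ_p`, with `S = J M⁻¹ Jᵀ`: `tr S^p` for `p > 0`, `log
det S` for `p = 0` and nonsingular `S`. Both are traces `tr H(S)` with `x ↦ H x⁻¹` convex and
decreasing, which is the case treated in `convexOn_trace_cfc`. Since `J` may have rank below `q`,
zero eigenvalues of `S` are followed throughout. -/

namespace PhiDesign

open Matrix

/-! ### Convexity of spectral trace functions of `J M⁻¹ Jᵀ` -/

section Spectral

variable {n m : Type*} [Fintype n] [Fintype m]

/-- Parseval's identity for the eigenvector basis of a symmetric real matrix. -/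
theorem sum_dotProduct_eigenvectorBasis_sq [DecidableEq n] {S : Matrix n n ℝ} (hS : S.IsHermitian) (x : n → ℝ) :
    ∑ i, ((hS.eigenvectorBasis i).ofLp ⬝ᵥ x) ^ 2 = x ⬝ᵥ x := by
  have h := hS.eigenvectorBasis.sum_sq_norm_inner_right (WithLp.toLp 2 x)
  rw [EuclideanSpace.real_norm_sq_eq] at h
  simp only [EuclideanSpace.inner_eq_star_dotProduct, star_trivial, Real.norm_eq_abs,
    sq_abs] at h
  simpa [dotProduct, sq, mul_comm] using h

theorem eigenvectorBasis_dotProduct [DecidableEq n] {S : Matrix n n ℝ} (hS : S.IsHermitian) (i j : n) :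
    (hS.eigenvectorBasis i).ofLp ⬝ᵥ (hS.eigenvectorBasis j).ofLp = if i = j then 1 else 0 := by
  have h := orthonormal_iff_ite.mp hS.eigenvectorBasis.orthonormal j i
  simp only [EuclideanSpace.inner_eq_star_dotProduct, star_trivial] at h
  rw [h]
  simp [eq_comm]

theorem trace_cfc_eq_sum [DecidableEq n] {S : Matrix n n ℝ} (hS : S.IsHermitian) (H : ℝ → ℝ) :
    (cfc H S).trace = ∑ i, H (hS.eigenvalues i) := by
  rw [hS.cfc_eq, IsHermitian.cfc, Unitary.conjStarAlgAut_apply, trace_mul_cycle]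
  simp [trace_diagonal]

theorem posSemidef_inv_conj [DecidableEq m] {M : Matrix m m ℝ} (hM : M.PosDef) (J : Matrix n m ℝ) :
    (J * M⁻¹ * Jᵀ).PosSemidef := by
  simpa using hM.inv.posSemidef.mul_mul_conjTranspose_same J

/-- A lower bound of the quadratic form of `M` on the fibre of `J` over `u`. -/
theorem two_mul_sub_le [DecidableEq m] {M : Matrix m m ℝ} (hM : M.PosDef) (J : Matrix n m ℝ) (x : m → ℝ)
    (y : n → ℝ) :
    2 * (y ⬝ᵥ J *ᵥ x) - y ⬝ᵥ (J * M⁻¹ * Jᵀ) *ᵥ y ≤ x ⬝ᵥ M *ᵥ x := by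
  have hdet : IsUnit M.det := hM.det_pos.ne'.isUnit
  have hsymm : Mᵀ = M := by simpa using hM.1.eq
  -- Completing the square: the claim is `0 ≤ (x - z)ᵀ M (x - z)` expanded.
  set z := M⁻¹ *ᵥ (Jᵀ *ᵥ y) with hz
  have hMz : M *ᵥ z = Jᵀ *ᵥ y := by
    rw [hz, mulVec_mulVec, mul_nonsing_inv _ hdet, one_mulVec]
  have h0 : 0 ≤ (x - z) ⬝ᵥ M *ᵥ (x - z) := by
    simpa using hM.posSemidef.dotProduct_mulVec_nonneg (x - z)
  have h1 : z ⬝ᵥ M *ᵥ x = x ⬝ᵥ M *ᵥ z := by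
    rw [dotProduct_mulVec, ← mulVec_transpose, hsymm, dotProduct_comm]
  have h2 : x ⬝ᵥ M *ᵥ z = y ⬝ᵥ J *ᵥ x := by
    rw [hMz, mulVec_transpose, dotProduct_comm, ← dotProduct_mulVec]
  have h3 : y ⬝ᵥ (J * M⁻¹ * Jᵀ) *ᵥ y = z ⬝ᵥ M *ᵥ z := by
    rw [hMz, ← mulVec_mulVec, ← mulVec_mulVec, ← hz, dotProduct_mulVec, mulVec_transpose,
      dotProduct_comm]
  rw [mulVec_sub, sub_dotProduct, dotProduct_sub, dotProduct_sub, h1] at h0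
  linarith

/-- The quadratic form of `J M⁻¹ Jᵀ` at `y` is that of `M⁻¹` at `Jᵀ y`. The kernel is therefore that
of `Jᵀ`, the same for every `M`. -/
theorem transpose_mulVec_eq_zero [DecidableEq m] {M : Matrix m m ℝ} (hM : M.PosDef) {J : Matrix n m ℝ}
    {y : n → ℝ} (hy : (J * M⁻¹ * Jᵀ) *ᵥ y = 0) : Jᵀ *ᵥ y = 0 := by
  by_contra hne
  have h := hM.inv.dotProduct_mulVec_pos hne
  have : Jᵀ *ᵥ y ⬝ᵥ M⁻¹ *ᵥ (Jᵀ *ᵥ y) = y ⬝ᵥ (J * M⁻¹ * Jᵀ) *ᵥ y := by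
    rw [← mulVec_mulVec, ← mulVec_mulVec, dotProduct_mulVec y, mulVec_transpose]
  rw [star_trivial, this, hy, dotProduct_zero] at h
  exact h.false

theorem mulVec_eigenvectorBasis' [DecidableEq n] {S : Matrix n n ℝ} (hS : S.IsHermitian) (i : n) :
    S *ᵥ (hS.eigenvectorBasis i).ofLp = hS.eigenvalues i • (hS.eigenvectorBasis i).ofLp :=
  hS.mulVec_eigenvectorBasis i

/-- This is `two_mul_sub_le` at the best `y`, found coordinatewise in the eigenbasis. With `0⁻¹ =
0`, null eigenvectors contribute nothing. -/
theorem sum_div_eigenvalues_le [DecidableEq n] [DecidableEq m] {M : Matrix m m ℝ} (hM : M.PosDef) {J : Matrix n m ℝ}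
    (hS : (J * M⁻¹ * Jᵀ).IsHermitian) (x : m → ℝ) :
    ∑ i, ((hS.eigenvectorBasis i).ofLp ⬝ᵥ J *ᵥ x) ^ 2 * (hS.eigenvalues i)⁻¹ ≤ x ⬝ᵥ M *ᵥ x := by
  set v := fun i => (hS.eigenvectorBasis i).ofLp
  set μ := hS.eigenvalues
  set c := fun i => (v i ⬝ᵥ J *ᵥ x) * (μ i)⁻¹
  have h := two_mul_sub_le hM J x (∑ i, c i • v i)
  have h1 : (∑ i, c i • v i) ⬝ᵥ J *ᵥ x = ∑ i, (v i ⬝ᵥ J *ᵥ x) ^ 2 * (μ i)⁻¹ := by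
    rw [sum_dotProduct]
    refine Finset.sum_congr rfl fun i _ => ?_
    simp only [smul_dotProduct, smul_eq_mul, c]
    ring
  have h2 : (∑ i, c i • v i) ⬝ᵥ (J * M⁻¹ * Jᵀ) *ᵥ (∑ i, c i • v i)
      = ∑ i, (v i ⬝ᵥ J *ᵥ x) ^ 2 * (μ i)⁻¹ := by
    rw [mulVec_sum, sum_dotProduct]
    refine Finset.sum_congr rfl fun i _ => ?_
    rw [dotProduct_sum, Finset.sum_eq_single i]
    · have : v i ⬝ᵥ v i = 1 := by simpa using eigenvectorBasis_dotProduct hS i i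
      rw [mulVec_smul, mulVec_eigenvectorBasis' hS i, smul_dotProduct, dotProduct_smul,
        dotProduct_smul, this]
      simp only [smul_eq_mul, c]
      change _ * (_ * (μ i * 1)) = _
      by_cases h0 : μ i = 0
      · simp [h0]
      · field_simp
    · intro j _ hj
      have : v i ⬝ᵥ v j = 0 := by simpa [hj.symm] using eigenvectorBasis_dotProduct hS i j
      rw [mulVec_smul, mulVec_eigenvectorBasis' hS j, smul_dotProduct, dotProduct_smul,
        dotProduct_smul, this]
      simp
    · simp
  rw [h1, h2] at h
  linarith

theorem quadForm_pos {M : Matrix m m ℝ} (hM : M.PosDef) {J : Matrix n m ℝ} {x : m → ℝ}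
    (hx : (J *ᵥ x) ⬝ᵥ (J *ᵥ x) = 1) : 0 < x ⬝ᵥ M *ᵥ x := by
  have : x ≠ 0 := by
    rintro rfl
    simp at hx
  simpa using hM.dotProduct_mulVec_pos this

/-- Jensen's inequality for one vector of the fibre. -/
theorem apply_inv_quadForm_le [DecidableEq n] [DecidableEq m] {H : ℝ → ℝ} (hconv : ConvexOn ℝ (Set.Ioi 0) fun x => H x⁻¹)
    (hanti : AntitoneOn (fun x => H x⁻¹) (Set.Ioi 0))
    {M : Matrix m m ℝ} (hM : M.PosDef) {J : Matrix n m ℝ} (hS : (J * M⁻¹ * Jᵀ).IsHermitian)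
    {x : m → ℝ} (hx : (J *ᵥ x) ⬝ᵥ (J *ᵥ x) = 1) :
    H (x ⬝ᵥ M *ᵥ x)⁻¹ ≤
      ∑ i, ((hS.eigenvectorBasis i).ofLp ⬝ᵥ J *ᵥ x) ^ 2 * H (hS.eigenvalues i) := by
  classical
  have hμ0 : ∀ i, 0 ≤ hS.eigenvalues i := (posSemidef_inv_conj hM J).eigenvalues_nonneg
  have hzero : ∀ i, hS.eigenvalues i = 0 →
      (hS.eigenvectorBasis i).ofLp ⬝ᵥ J *ᵥ x = 0 := by
    intro i hi
    have := transpose_mulVec_eq_zero hM (J := J) (y := (hS.eigenvectorBasis i).ofLp)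
      (by rw [mulVec_eigenvectorBasis' hS i, hi, zero_smul])
    rw [dotProduct_mulVec, ← mulVec_transpose, this, zero_dotProduct]
  have hle := sum_div_eigenvalues_le hM hS x
  have hone := sum_dotProduct_eigenvectorBasis_sq hS (J *ᵥ x)
  rw [hx] at hone
  set P := fun i => ((hS.eigenvectorBasis i).ofLp ⬝ᵥ J *ᵥ x) ^ 2 with hP
  -- Null eigenvectors are orthogonal to `J x`, so the weights `P` on `s` still sum to 1 and Jensen
  -- applies at positive points only.
  set s := Finset.univ.filter fun i => hS.eigenvalues i ≠ 0
  have hrestrict : ∀ F : n → ℝ, ∑ i ∈ s, P i * F i = ∑ i, P i * F i := by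
    intro F
    refine Finset.sum_subset (Finset.subset_univ _) fun i _ hi => ?_
    have : hS.eigenvalues i = 0 := by simpa [s] using hi
    simp [hP, hzero i this]
  have hone' : ∑ i ∈ s, P i = 1 := by
    simpa only [mul_one, hone] using hrestrict fun _ => 1
  have hmem : ∀ i ∈ s, (hS.eigenvalues i)⁻¹ ∈ Set.Ioi (0 : ℝ) := fun i hi =>
    inv_pos.mpr ((hμ0 i).lt_of_ne' (by simpa [s] using hi))
  have hP0 : ∀ i ∈ s, 0 ≤ P i := fun i _ => sq_nonneg _
  have hmean := hconv.1.sum_mem hP0 hone' hmem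
  have hjensen := hconv.map_sum_le hP0 hone' hmem
  simp only [smul_eq_mul, hrestrict, inv_inv] at hmean hjensen
  exact (hanti hmean (quadForm_pos hM hx) hle).trans hjensen

/-- `M ↦ tr H(J M⁻¹ Jᵀ)` is convex when `x ↦ H x⁻¹` is convex and decreasing. -/
theorem convexOn_trace_cfc [DecidableEq n] [DecidableEq m] {H : ℝ → ℝ} (hconv : ConvexOn ℝ (Set.Ioi 0) fun x => H x⁻¹)
    (hanti : AntitoneOn (fun x => H x⁻¹) (Set.Ioi 0)) (hH0 : H 0 = 0) (J : Matrix n m ℝ) :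
    ConvexOn ℝ {M : Matrix m m ℝ | M.PosDef} fun M => (cfc H (J * M⁻¹ * Jᵀ)).trace := by
  classical
  have hset : Convex ℝ {M : Matrix m m ℝ | M.PosDef} := by
    refine convex_iff_forall_pos.mpr fun M hM M' hM' a b ha hb _ => ?_
    exact (PosDef.smul hM ha).add (PosDef.smul hM' hb)
  refine ⟨hset, fun M₀ hM₀ M₁ hM₁ a b ha hb hab => ?_⟩
  have hM : (a • M₀ + b • M₁).PosDef := hset hM₀ hM₁ ha hb hab
  set M := a • M₀ + b • M₁ with hMdef
  have hS := (posSemidef_inv_conj hM J).1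
  set u := fun j => (hS.eigenvectorBasis j).ofLp
  set l := hS.eigenvalues
  -- For `l j ≠ 0`, `x j` attains the minimum of `xᵀ M x` on the fibre `J x = u j`, namely `(l
  -- j)⁻¹`.
  set x := fun j => (l j)⁻¹ • (M⁻¹ *ᵥ (Jᵀ *ᵥ u j)) with hx
  have hSu : ∀ j, (J * M⁻¹ * Jᵀ) *ᵥ u j = l j • u j := mulVec_eigenvectorBasis' hS
  have hu1 : ∀ j, u j ⬝ᵥ u j = 1 := fun j => by
    simpa using eigenvectorBasis_dotProduct hS j j
  have hJx : ∀ j, l j ≠ 0 → J *ᵥ x j = u j := by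
    intro j hj
    simp only [hx, mulVec_smul]
    rw [mulVec_mulVec, mulVec_mulVec, hSu, smul_smul, inv_mul_cancel₀ hj, one_smul]
  have hxMx : ∀ j, l j ≠ 0 → x j ⬝ᵥ M *ᵥ x j = (l j)⁻¹ := by
    intro j hj
    have h1 : M *ᵥ x j = (l j)⁻¹ • (Jᵀ *ᵥ u j) := by
      simp only [hx, mulVec_smul]
      rw [mulVec_mulVec, mul_nonsing_inv _ hM.det_pos.ne'.isUnit, one_mulVec]
    rw [h1, dotProduct_smul, mulVec_transpose, dotProduct_comm, ← dotProduct_mulVec, hJx j hj,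
      hu1, smul_eq_mul, mul_one]
  have hker : ∀ j, l j = 0 → Jᵀ *ᵥ u j = 0 := fun j hj =>
    transpose_mulVec_eq_zero hM (by rw [hSu, hj, zero_smul])
  set s := Finset.univ.filter fun j => l j ≠ 0 with hs
  have hmems : ∀ j ∈ s, l j ≠ 0 := fun j hj => by simpa [hs] using hj
  -- The same `x j` serve as test vectors for every `M'`: Jensen for each `j`, then summation over
  -- `j` of squared inner products of two orthonormal bases.
  have key : ∀ M' : Matrix m m ℝ, M'.PosDef →
      ∑ j ∈ s, H (x j ⬝ᵥ M' *ᵥ x j)⁻¹ ≤ (cfc H (J * M'⁻¹ * Jᵀ)).trace := by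
    intro M' hM'
    have hS' := (posSemidef_inv_conj hM' J).1
    rw [trace_cfc_eq_sum hS']
    calc ∑ j ∈ s, H (x j ⬝ᵥ M' *ᵥ x j)⁻¹
        ≤ ∑ j ∈ s, ∑ i, ((hS'.eigenvectorBasis i).ofLp ⬝ᵥ u j) ^ 2 * H (hS'.eigenvalues i) := by
          refine Finset.sum_le_sum fun j hj => ?_
          have h := apply_inv_quadForm_le hconv hanti hM' hS' (x := x j)
            (by rw [hJx j (hmems j hj), hu1])
          rwa [hJx j (hmems j hj)] at h
      _ = ∑ i, (∑ j ∈ s, ((hS'.eigenvectorBasis i).ofLp ⬝ᵥ u j) ^ 2) * H (hS'.eigenvalues i) := by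
          rw [Finset.sum_comm]
          simp only [Finset.sum_mul]
      _ = ∑ i, H (hS'.eigenvalues i) := by
          refine Finset.sum_congr rfl fun i _ => ?_
          by_cases hi : hS'.eigenvalues i = 0
          · simp [hi, hH0]
          -- The omitted `u j` lie in the kernel of `Jᵀ`, hence are orthogonal to this eigenvector.
          -- The weights sum to exactly 1, which matters because `H` may be negative.
          have h1 : ∑ j ∈ s, ((hS'.eigenvectorBasis i).ofLp ⬝ᵥ u j) ^ 2
              = ∑ j, ((hS'.eigenvectorBasis i).ofLp ⬝ᵥ u j) ^ 2 := by
            refine Finset.sum_subset (Finset.subset_univ _) fun j _ hj => ?_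
            have hj0 : l j = 0 := by simpa [hs] using hj
            have h2 : hS'.eigenvalues i * ((hS'.eigenvectorBasis i).ofLp ⬝ᵥ u j) = 0 := by
              rw [← smul_eq_mul, ← smul_dotProduct, ← mulVec_eigenvectorBasis' hS' i,
                ← mulVec_mulVec, ← mulVec_mulVec, dotProduct_comm, dotProduct_mulVec,
                ← mulVec_transpose, hker j hj0, zero_dotProduct]
            rw [(mul_eq_zero.mp h2).resolve_left hi]
            simp
          have h2 := sum_dotProduct_eigenvectorBasis_sq hS (hS'.eigenvectorBasis i).ofLp
          have h3 : (hS'.eigenvectorBasis i).ofLp ⬝ᵥ (hS'.eigenvectorBasis i).ofLp = 1 := by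
            simpa using eigenvectorBasis_dotProduct hS' i i
          rw [h1, Finset.sum_congr rfl fun j _ => by rw [dotProduct_comm], h2, h3, one_mul]
  calc (cfc H (J * M⁻¹ * Jᵀ)).trace = ∑ j, H (l j) := trace_cfc_eq_sum hS H
    _ = ∑ j ∈ s, H (l j) := by
        refine (Finset.sum_subset (Finset.subset_univ _) fun j _ hj => ?_).symm
        have hj0 : l j = 0 := by simpa [hs] using hj
        rw [hj0, hH0]
    _ ≤ ∑ j ∈ s, (a * H (x j ⬝ᵥ M₀ *ᵥ x j)⁻¹ + b * H (x j ⬝ᵥ M₁ *ᵥ x j)⁻¹) := by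
        refine Finset.sum_le_sum fun j hj => ?_
        have hlj := hmems j hj
        have h1 : (J *ᵥ x j) ⬝ᵥ (J *ᵥ x j) = 1 := by rw [hJx j hlj, hu1]
        have h := hconv.2 (quadForm_pos hM₀ h1) (quadForm_pos hM₁ h1) ha hb hab
        have h2 : a • (x j ⬝ᵥ M₀ *ᵥ x j) + b • (x j ⬝ᵥ M₁ *ᵥ x j) = (l j)⁻¹ := by
          rw [← hxMx j hlj, hMdef, add_mulVec, dotProduct_add, smul_mulVec, smul_mulVec,
            dotProduct_smul, dotProduct_smul]
        rw [h2] at h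
        simpa only [inv_inv, smul_eq_mul] using h
    _ = a * ∑ j ∈ s, H (x j ⬝ᵥ M₀ *ᵥ x j)⁻¹ + b * ∑ j ∈ s, H (x j ⬝ᵥ M₁ *ᵥ x j)⁻¹ := by
        rw [Finset.sum_add_distrib, Finset.mul_sum, Finset.mul_sum]
    _ ≤ a • (cfc H (J * M₀⁻¹ * Jᵀ)).trace + b • (cfc H (J * M₁⁻¹ * Jᵀ)).trace := by
        have := mul_le_mul_of_nonneg_left (key M₀ hM₀) ha
        have := mul_le_mul_of_nonneg_left (key M₁ hM₁) hb
        simp only [smul_eq_mul]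
        linarith

/-- Positive definiteness is stable under small symmetric perturbations. -/
theorem eventually_posDef_add_smul {M D : Matrix m m ℝ} (hM : M.PosDef) (hD : D.IsHermitian) :
    ∀ᶠ a : ℝ in 𝓝 0, (M + a • D).PosDef := by
  have h : ∀ᶠ a : ℝ in 𝓝 0, ∀ x ∈ Metric.sphere (0 : m → ℝ) 1, 0 < x ⬝ᵥ (M + a • D) *ᵥ x := by
    refine (isCompact_sphere (0 : m → ℝ) 1).eventually_forall_of_forall_eventually fun x hx => ?_
    have hc : Continuous fun z : ℝ × (m → ℝ) => z.2 ⬝ᵥ (M + z.1 • D) *ᵥ z.2 := by fun_prop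
    refine hc.continuousAt.eventually (lt_mem_nhds ?_)
    have hx0 : x ≠ 0 := by
      rintro rfl
      simp at hx
    simpa using hM.dotProduct_mulVec_pos hx0
  filter_upwards [h] with a ha
  refine PosDef.of_dotProduct_mulVec_pos (hM.1.add (hD.smul (star_trivial a))) fun x hx => ?_
  have hn : 0 < ‖x‖ := norm_pos_iff.mpr hx
  have h1 := ha (‖x‖⁻¹ • x) (by simp [norm_smul, hn.ne'])
  rw [mulVec_smul, dotProduct_smul, smul_dotProduct, smul_eq_mul, smul_eq_mul] at h1
  have hi : 0 < ‖x‖⁻¹ := inv_pos.mpr hn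
  simpa using pos_of_mul_pos_right (pos_of_mul_pos_right h1 hi.le) hi.le

end Spectral

/-! ### Scalar powers, logarithms and one-sided derivatives -/

theorem convexOn_rpow_inv {p : ℝ} (hp : 0 ≤ p) :
    ConvexOn ℝ (Set.Ioi 0) fun x : ℝ => x⁻¹ ^ p := by
  -- The function is the increasing convex `exp` composed with the convex `-p log x`.
  have h : ConvexOn ℝ (Set.Ioi 0) fun x : ℝ => Real.exp (p • (-Real.log) x) := by
    have hlog := strictConcaveOn_log_Ioi.concaveOn.neg.smul hp
    refine ⟨hlog.1, fun x hx y hy a b ha hb hab => ?_⟩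
    exact (Real.exp_monotone (hlog.2 hx hy ha hb hab)).trans
      (convexOn_exp.2 trivial trivial ha hb hab)
  refine h.congr fun x hx => ?_
  rw [Real.rpow_def_of_pos (inv_pos.mpr hx), Real.log_inv]
  simp [mul_comm]

theorem antitoneOn_rpow_inv {p : ℝ} (hp : 0 ≤ p) :
    AntitoneOn (fun x : ℝ => x⁻¹ ^ p) (Set.Ioi 0) := fun _ hx _ hy hxy =>
  Real.rpow_le_rpow (inv_nonneg.mpr (le_of_lt hy)) (inv_anti₀ hx hxy) hp

theorem convexOn_log_inv : ConvexOn ℝ (Set.Ioi 0) fun x : ℝ => Real.log x⁻¹ :=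
  strictConcaveOn_log_Ioi.concaveOn.neg.congr fun x _ => by simp [Real.log_inv]

theorem antitoneOn_log_inv : AntitoneOn (fun x : ℝ => Real.log x⁻¹) (Set.Ioi 0) :=
  fun _ hx _ hy hxy => Real.log_le_log (inv_pos.mpr hy) (inv_anti₀ hx hxy)

/-- If an increasing smooth transform of a convex function has a nonnegative right derivative
at `0`, then the convex function does not decrease from `0` to `1`. -/
theorem le_of_derivWithin_comp_nonneg {S : Set ℝ} {G F φ : ℝ → ℝ} {c : ℝ} (hG : ConvexOn ℝ S G)
    (h0 : S ∈ 𝓝 0) (h1 : 1 ∈ S) (hc : 0 < c) (hF : HasDerivAt F c (G 0))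
    (hφ : φ =ᶠ[𝓝 0] F ∘ G) (hd : 0 ≤ derivWithin φ (Set.Ici 0) 0) : G 0 ≤ G 1 := by
  have h0' : (0 : ℝ) ∈ interior S := mem_interior_iff_mem_nhds.mpr h0
  have hG' := hG.hasDerivWithinAt_rightDeriv_of_mem_interior h0'
  have hslope := hG.rightDeriv_le_slope_of_mem_interior h0' h1 zero_lt_one
  set g := derivWithin G (Set.Ioi 0) 0
  have hφ' : HasDerivWithinAt φ (c * g) (Set.Ici 0) 0 :=
    (hF.comp_hasDerivWithinAt 0 hG'.Ici_of_Ioi).congr_of_eventuallyEq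
      (hφ.filter_mono nhdsWithin_le_nhds) hφ.eq_of_nhds
  rw [hφ'.derivWithin (uniqueDiffWithinAt_Ici 0)] at hd
  have hg : 0 ≤ g := nonneg_of_mul_nonneg_right hd hc
  rw [slope_def_field] at hslope
  linarith

/-! ### First-order optimality for Kiefer's criterion -/

section Criterion

variable {q k : ℕ} {p : ℝ}

theorem trace_cfc_rpow_nonneg {S : Matrix (Fin q) (Fin q) ℝ} (hS : S.PosSemidef) :
    0 ≤ (cfc (fun x : ℝ => x ^ p) S).trace := by
  rw [trace_cfc_eq_sum hS.1]
  exact Finset.sum_nonneg fun i _ => Real.rpow_nonneg (hS.eigenvalues_nonneg i) p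

theorem Phi_nonneg {S : Matrix (Fin q) (Fin q) ℝ} (hS : S.PosSemidef) : 0 ≤ Phi p S := by
  unfold Phi
  split_ifs
  · exact Real.rpow_nonneg hS.det_nonneg _
  · exact Real.rpow_nonneg (mul_nonneg (by positivity) (trace_cfc_rpow_nonneg hS)) _

theorem log_det_eq_trace_cfc {S : Matrix (Fin q) (Fin q) ℝ} (hS : S.PosDef) :
    Real.log S.det = (cfc Real.log S).trace := by
  rw [trace_cfc_eq_sum hS.1, hS.1.det_eq_prod_eigenvalues]
  exact Real.log_prod fun i _ => (hS.eigenvalues_pos i).ne'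

/-- Nonsingularity is essential: `Real.log 0 = 0` would hide a zero eigenvalue from the trace. -/
theorem Phi_zero_eq_exp {S : Matrix (Fin q) (Fin q) ℝ} (hS : S.PosDef) :
    Phi 0 S = Real.exp ((cfc Real.log S).trace * (1 / (q : ℝ))) := by
  rw [← log_det_eq_trace_cfc hS, Phi, if_pos rfl, Real.rpow_def_of_pos hS.det_pos]

/-- Whether `J M⁻¹ Jᵀ` is nonsingular does not depend on the positive definite matrix `M`. -/
theorem posDef_inv_conj_of_det_ne_zero {J : Matrix (Fin q) (Fin k) ℝ}
    {M M' : Matrix (Fin k) (Fin k) ℝ} (hM' : M'.PosDef) (hdet : (J * M⁻¹ * Jᵀ).det ≠ 0) :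
    (J * M'⁻¹ * Jᵀ).PosDef := by
  have hS := posSemidef_inv_conj hM' J
  refine hS.posDef_iff_isUnit.mpr (Matrix.mulVec_injective_iff_isUnit.mp ?_)
  refine (injective_iff_map_eq_zero (Matrix.mulVecLin (J * M'⁻¹ * Jᵀ))).mpr fun y hy => ?_
  refine Matrix.eq_zero_of_mulVec_eq_zero hdet ?_
  rw [← mulVec_mulVec, transpose_mulVec_eq_zero hM' hy, mulVec_zero]

/-- A nonnegative directional derivative of `Φ_p(J M⁻¹ Jᵀ)` in the direction of `M₁` means that
`M₁` does not improve on `M₀`. -/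
theorem Phi_le_of_derivWithin_nonneg (hq : 1 ≤ q) (hp : 0 ≤ p) (J : Matrix (Fin q) (Fin k) ℝ)
    {M₀ M₁ : Matrix (Fin k) (Fin k) ℝ} (hM₀ : M₀.PosDef) (hM₁ : M₁.PosDef)
    (hd : 0 ≤ derivWithin (fun a : ℝ => Phi p (J * (M₀ + a • (M₁ - M₀))⁻¹ * Jᵀ)) (Set.Ici 0) 0) :
    Phi p (J * M₀⁻¹ * Jᵀ) ≤ Phi p (J * M₁⁻¹ * Jᵀ) := by
  have hq0 : (0 : ℝ) < q := by exact_mod_cast hq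
  -- A zero value is already minimal. A positive one makes `S` nonsingular if `p = 0`, and its trace
  -- of powers positive if `p > 0`, so that the outer transform has a positive derivative there.
  rcases (Phi_nonneg (p := p) (posSemidef_inv_conj hM₀ J)).eq_or_lt with hz | hpos
  · rw [← hz]
    exact Phi_nonneg (posSemidef_inv_conj hM₁ J)
  have hS := eventually_posDef_add_smul hM₀ (hM₁.1.sub hM₀.1)
  have hline : ∀ a : ℝ, AffineMap.lineMap M₀ M₁ a = M₀ + a • (M₁ - M₀) := fun a => by
    rw [AffineMap.lineMap_apply, vsub_eq_sub, vadd_eq_add, add_comm]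
  have hconvex : ∀ H : ℝ → ℝ, ConvexOn ℝ (Set.Ioi 0) (fun x => H x⁻¹) →
      AntitoneOn (fun x => H x⁻¹) (Set.Ioi 0) → H 0 = 0 →
      ConvexOn ℝ {a : ℝ | (M₀ + a • (M₁ - M₀)).PosDef}
        fun a => (cfc H (J * (M₀ + a • (M₁ - M₀))⁻¹ * Jᵀ)).trace := by
    intro H h1 h2 h3
    have h := (convexOn_trace_cfc h1 h2 h3 J).comp_affineMap (AffineMap.lineMap M₀ M₁)
    simpa only [Function.comp_def, Set.preimage_ofPred_eq, hline] using h
  have hone : M₀ + (1 : ℝ) • (M₁ - M₀) = M₁ := by simp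
  have hmem : (1 : ℝ) ∈ {a : ℝ | (M₀ + a • (M₁ - M₀)).PosDef} := by
    rw [Set.mem_ofPred_eq, hone]
    exact hM₁
  rcases hp.eq_or_lt with rfl | hp'
  · have hdet : (J * M₀⁻¹ * Jᵀ).det ≠ 0 := by
      intro h
      rw [Phi, if_pos rfl, h, Real.zero_rpow (by positivity)] at hpos
      exact hpos.false
    have hle := le_of_derivWithin_comp_nonneg
      (F := fun y => Real.exp (y * (1 / (q : ℝ))))
      (hconvex Real.log convexOn_log_inv antitoneOn_log_inv Real.log_zero) hS hmem
      (by positivity) (((hasDerivAt_id _).mul_const _).exp)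
      (by
        filter_upwards [hS] with a ha
        exact Phi_zero_eq_exp (posDef_inv_conj_of_det_ne_zero ha hdet)) hd
    simp only [zero_smul, add_zero, hone] at hle
    rw [Phi_zero_eq_exp (posDef_inv_conj_of_det_ne_zero hM₀ hdet),
      Phi_zero_eq_exp (posDef_inv_conj_of_det_ne_zero hM₁ hdet)]
    gcongr
  · set T := fun S : Matrix (Fin q) (Fin q) ℝ => (cfc (fun x : ℝ => x ^ p) S).trace
    have hPhi : ∀ S, Phi p S = ((q : ℝ)⁻¹ * T S) ^ (1 / p) := fun S => by
      rw [Phi, if_neg hp'.ne']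
    have hT0 : 0 < T (J * M₀⁻¹ * Jᵀ) := by
      refine (trace_cfc_rpow_nonneg (posSemidef_inv_conj hM₀ J)).lt_of_ne fun h => hpos.ne ?_
      rw [hPhi, show T (J * M₀⁻¹ * Jᵀ) = 0 from h.symm, mul_zero, Real.zero_rpow (by positivity)]
    have hT0' : 0 < T (J * (M₀ + (0 : ℝ) • (M₁ - M₀))⁻¹ * Jᵀ) := by
      rwa [zero_smul, add_zero]
    have hle := le_of_derivWithin_comp_nonneg
      (F := fun y => ((q : ℝ)⁻¹ * y) ^ (1 / p))
      (hconvex (fun x => x ^ p) (convexOn_rpow_inv hp) (antitoneOn_rpow_inv hp)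
        (Real.zero_rpow hp'.ne')) hS hmem (by positivity)
      (((hasDerivAt_id _).const_mul _).rpow_const (Or.inl (by
        exact (mul_pos (inv_pos.mpr hq0) hT0').ne')))
      (Eventually.of_forall fun a => hPhi _) hd
    simp only [zero_smul, add_zero, hone] at hle
    rw [hPhi, hPhi]
    have := hT0.le
    gcongr

end Criterion

/-! ### Monotonicity and finite termination of the algorithm -/

section Algorithm

variable {N k q : ℕ} {p ε : ℝ} {J : Matrix (Fin q) (Fin k) ℝ}
  {A : Fin N → Matrix (Fin k) (Fin k) ℝ}

theorem infoMatrix_segment (A : Fin N → Matrix (Fin k) (Fin k) ℝ) (w w' : Fin N → ℝ) (a : ℝ) :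
    infoMatrix A ((1 - a) • w + a • w')
      = infoMatrix A w + a • (infoMatrix A w' - infoMatrix A w) := by
  simp only [infoMatrix, ← Finset.sum_sub_distrib, Finset.smul_sum, ← Finset.sum_add_distrib]
  refine Finset.sum_congr rfl fun i _ => ?_
  simp only [Pi.add_apply, Pi.smul_apply, smul_eq_mul]
  module

theorem objective_of_posDef {w : Fin N → ℝ} (h : (infoMatrix A w).PosDef) :
    objective p J A w = ((Phi p (covMatrix J A w) : ℝ) : EReal) := if_pos h

theorem posDef_of_objective_le {w w' : Fin N → ℝ} (h : (infoMatrix A w').PosDef)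
    (hle : objective p J A w ≤ objective p J A w') : (infoMatrix A w).PosDef := by
  by_contra hne
  rw [objective_of_posDef h, objective, if_neg hne] at hle
  exact absurd hle (not_le.mpr (EReal.coe_lt_top _))

theorem Phi_le_of_objective_le {w w' : Fin N → ℝ} (h : (infoMatrix A w').PosDef)
    (hle : objective p J A w ≤ objective p J A w') :
    Phi p (covMatrix J A w) ≤ Phi p (covMatrix J A w') := by
  rwa [objective_of_posDef (posDef_of_objective_le h hle), objective_of_posDef h,
    EReal.coe_le_coe_iff] at hle

/-- An update fixes only weights on which `w` and `v` agree, so moving from `w` towards `v` is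
always allowed. -/
theorem segment_mem_updateSet {w v : Fin N → ℝ} (hw : w ∈ Omega N ε) (hv : v ∈ Omega N ε) {a : ℝ}
    (ha0 : 0 ≤ a) (ha1 : a ≤ 1) : (1 - a) • w + a • v ∈ updateSet ε w v := by
  refine ⟨⟨fun i => ?_, ?_⟩, fun i h1 h2 => ?_, fun i h1 h2 => ?_⟩
  · obtain ⟨h1, h2⟩ := hw.1 i
    obtain ⟨h3, h4⟩ := hv.1 i
    simp only [Pi.add_apply, Pi.smul_apply, smul_eq_mul]
    constructor <;> nlinarith
  · simp only [Pi.add_apply, Pi.smul_apply, smul_eq_mul, Finset.sum_add_distrib,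
      ← Finset.mul_sum, hw.2, hv.2]
    ring
  · simp only [Pi.add_apply, Pi.smul_apply, smul_eq_mul, h1, h2]
    ring
  · simp [h1, h2]

theorem posDef_segment {w v : Fin N → ℝ} (hw : (infoMatrix A w).PosDef)
    (hv : (infoMatrix A v).PosDef) {a : ℝ} (ha0 : 0 ≤ a) (ha1 : a ≤ 1) :
    (infoMatrix A ((1 - a) • w + a • v)).PosDef := by
  have h : infoMatrix A ((1 - a) • w + a • v)
      = (1 - a) • infoMatrix A w + a • infoMatrix A v := by
    rw [infoMatrix_segment]
    module
  rw [h]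
  rcases ha0.eq_or_lt with rfl | ha
  · simpa using hw
  · exact PosDef.posSemidef_add (hw.posSemidef.smul (sub_nonneg.mpr ha1)) (hv.smul ha)

/-- A measure that is optimal for its own update has a nonnegative derivative in the direction of
its PSG measure. -/
theorem eta_nonneg_of_isSolution {w v : Fin N → ℝ} (hw : w ∈ OmegaPlus ε A)
    (hv : v ∈ OmegaPlus ε A)
    (hmin : ∀ u ∈ updateSet ε w v, objective p J A w ≤ objective p J A u) :
    0 ≤ eta p J A v w := by
  set φ := fun a : ℝ => Phi p (covMatrix J A ((1 - a) • w + a • v)) with hφ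
  have hloc : IsLocalMinOn φ (Set.Ici 0) 0 := by
    filter_upwards [self_mem_nhdsWithin, nhdsWithin_le_nhds (gt_mem_nhds zero_lt_one)] with a h0 h1
    have := Phi_le_of_objective_le (posDef_segment hw.2 hv.2 h0 h1.le)
      (hmin _ (segment_mem_updateSet hw.1 hv.1 h0 h1.le))
    simpa [hφ] using this
  refine hloc.fderivWithin_nonneg (mem_posTangentConeAt_of_segment_subset ?_)
  rw [zero_add, segment_eq_Icc zero_le_one]
  exact Set.Icc_subset_Ici_self

theorem Phi_le_of_eta_nonneg (hq : 1 ≤ q) (hp : 0 ≤ p) {w w' : Fin N → ℝ}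
    (hw : (infoMatrix A w).PosDef) (hw' : (infoMatrix A w').PosDef) (h : 0 ≤ eta p J A w' w) :
    Phi p (covMatrix J A w) ≤ Phi p (covMatrix J A w') := by
  refine Phi_le_of_derivWithin_nonneg hq hp J hw hw' ?_
  simpa only [eta, covMatrix, infoMatrix_segment] using h

namespace IsRun

variable {w v : ℕ → Fin N → ℝ}

theorem mem_omegaPlus (hrun : IsRun p ε J A w v) (t : ℕ) : w t ∈ OmegaPlus ε A := by
  induction t with
  | zero => exact hrun.init
  | succ t ih =>
    obtain ⟨hmem, hmin⟩ := hrun.update t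
    refine ⟨hmem.1, posDef_of_objective_le ih.2 (hmin _ ⟨ih.1, fun i h _ => h, fun i h _ => h⟩)⟩

theorem antitone_Phi (hrun : IsRun p ε J A w v) :
    Antitone fun t => Phi p (covMatrix J A (w t)) := by
  refine antitone_nat_of_succ_le fun t => ?_
  have ht := hrun.mem_omegaPlus t
  exact Phi_le_of_objective_le ht.2
    ((hrun.update t).2 _ ⟨ht.1, fun i h _ => h, fun i h _ => h⟩)

/-- There are finitely many update problems, so that some update does not improve the measure. -/
theorem exists_objective_le (hrun : IsRun p ε J A w v) :
    ∃ t, objective p J A (w t) ≤ objective p J A (w (t + 1)) := by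
  classical
  obtain ⟨s, t, hst, heq⟩ := Finite.exists_ne_map_eq_of_infinite fun t : ℕ =>
    (({i | w t i = ε ∧ v t i = ε}, {i | w t i = 0 ∧ v t i = 0}) : Set (Fin N) × Set (Fin N))
  wlog hlt : s < t generalizing s t
  · exact this t s hst.symm heq.symm (hst.lt_or_gt.resolve_left hlt)
  have h1 : ∀ i, w s i = ε ∧ v s i = ε ↔ w t i = ε ∧ v t i = ε :=
    Set.ext_iff.mp (congrArg Prod.fst heq)
  have h2 : ∀ i, w s i = 0 ∧ v s i = 0 ↔ w t i = 0 ∧ v t i = 0 :=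
    Set.ext_iff.mp (congrArg Prod.snd heq)
  have hset : updateSet ε (w s) (v s) = updateSet ε (w t) (v t) := by
    ext u
    simp only [updateSet, Set.mem_ofPred_eq, ← and_imp, h1, h2]
  -- `w (s + 1)` is optimal on a set containing `w (t + 1)`, and `s + 2 ≤ t + 1` lets monotonicity
  -- compare with `w (s + 2)`.
  refine ⟨s + 1, ?_⟩
  have hle : objective p J A (w (s + 1)) ≤ objective p J A (w (t + 1)) :=
    (hrun.update s).2 _ (hset ▸ (hrun.update t).1)
  rw [objective_of_posDef (hrun.mem_omegaPlus _).2, objective_of_posDef (hrun.mem_omegaPlus _).2,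
    EReal.coe_le_coe_iff] at hle ⊢
  exact hle.trans (hrun.antitone_Phi (by omega))

/-- At a non-improving step the derivative towards the PSG measure is nonnegative; being the least
one, it bounds all others from below. -/
theorem exists_Phi_le (hrun : IsRun p ε J A w v) (hq : 1 ≤ q) (hp : 0 ≤ p) :
    ∃ t, ∀ w' ∈ OmegaPlus ε A, Phi p (covMatrix J A (w t)) ≤ Phi p (covMatrix J A w') := by
  obtain ⟨t, ht⟩ := hrun.exists_objective_le
  refine ⟨t, fun w' hw' => ?_⟩
  have hw := hrun.mem_omegaPlus t
  refine Phi_le_of_eta_nonneg hq hp hw.2 hw'.2 (le_trans ?_ ((hrun.psg t).2 w' hw'))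
  exact eta_nonneg_of_isSolution hw (hrun.psg t).1 fun u hu => ht.trans ((hrun.update t).2 u hu)

end IsRun

end Algorithm

end PhiDesign

theorem mainTheorem1 {N k q : ℕ} (hq : 1 ≤ q) (hqk : q ≤ k)
    (p : ℝ) (hp : 0 ≤ p) (ε : ℝ) (hε0 : 0 < ε) (hε1 : ε < 1)
    (A : Fin N → Matrix (Fin k) (Fin k) ℝ) (hA : ∀ i, (A i).PosSemidef)
    (g : (Fin k → ℝ) → (Fin q → ℝ)) (θ : Fin k → ℝ) (hg : DifferentiableAt ℝ g θ)
    (w v : ℕ → Fin N → ℝ) (hrun : PhiDesign.IsRun p ε (PhiDesign.jacobian g θ) A w v)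
    (what : Fin N → ℝ)
    (hwhat : PhiDesign.IsSolution p (PhiDesign.jacobian g θ) A (PhiDesign.Omega N ε) what) :
    (∀ t, (PhiDesign.infoMatrix A (w t)).PosDef) ∧ (PhiDesign.infoMatrix A what).PosDef ∧
      Tendsto (fun t => PhiDesign.Phi p (PhiDesign.covMatrix (PhiDesign.jacobian g θ) A (w t)))
        atTop (𝓝 (PhiDesign.Phi p (PhiDesign.covMatrix (PhiDesign.jacobian g θ) A what))) := by
  obtain ⟨hmem, hmin⟩ := hwhat
  have hposw : ∀ t, (PhiDesign.infoMatrix A (w t)).PosDef := fun t => (hrun.mem_omegaPlus t).2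
  have hpos : (PhiDesign.infoMatrix A what).PosDef :=
    PhiDesign.posDef_of_objective_le hrun.init.2 (hmin _ hrun.init.1)
  refine ⟨hposw, hpos, ?_⟩
  obtain ⟨t, ht⟩ := hrun.exists_Phi_le hq hp
  refine tendsto_atTop_of_eventually_const (i₀ := t) fun s hs => le_antisymm ?_ ?_
  · exact (hrun.antitone_Phi hs).trans (ht what ⟨hmem, hpos⟩)
  · exact PhiDesign.Phi_le_of_objective_le (hposw s) (hmin _ (hrun.mem_omegaPlus s).1)
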